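/- Let $R_3=-\tfrac34$. Let $\Lambda$ be a (possibly unbounded) operator on the complex space $L^2(\mathbb S^2)$ (with surface measure) such that $-\Lambda$ is self-adjoint and non-negative, its spectrum consists of eigenvalues and has no finite accumulation point, and $0$ is an eigenvalue of $-\Lambda$. Let $E$ be the set of nonzero eigenvalues of $-\Lambda$. (i) If $E\neq\emptyset$, then the function $\lambda\mapsto -R_3^2\left(\frac1\lambda+\frac1{R_3}\right)^2+1$ attains a maximum on $E$. (ii) Let $\lambda_{k_0}\in E$ be any point at which this maximum is attained, and suppose $\lambda_{k_0}\ne-R_3$. Then $$\left\|\frac{\Lambda f}{|x|^2}\right\|_{L^2(\mathbb R^3)}^2\le\left(\frac{\lambda_{k_0}}{\lambda_{k_0}+R_3}\right)^2\|\mathcal L f\|_{L^2(\mathbb R^3)}^2,\qquad \mathcal L f=\Delta_r f+\frac{1}{|x|^2}\Lambda f,\quad \Delta_r=\partial_r^2+\frac{2}{|x|}\partial_r,$$ where $\partial_r$ is the derivative along rays from the origin and norms may be infinite. This holds for every $f\in C_c^\infty(\mathbb R^3\setminus\{0\};\mathbb C)$ such that $f(r\,\cdot)$ lies in the domain of $\Lambda$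 for almost every $r>0$; here $\Lambda f$ is the measurable function on $\mathbb R^3$ given by $(\Lambda f)(r\,\cdot)=\Lambda(f(r\,\cdot))$ for almost every $r>0$. More generally, it suffices to replace $f\in C_c^\infty(\mathbb R^3\setminus\{0\};\mathbb C)$ by: $f:\mathbb R^3\to\mathbb C$ is Borel measurable, vanishes outside some shell $\{a\le|x|\le b\}$ with $a>0$, $t\mapsto f(t\theta)$ is $C^2$ on $\mathbb R$ for every $\theta\in\mathbb S^2$, and there is $G\in L^2(\mathbb S^2)$ with $|\partial_r^2f(r\theta)|\le G(\theta)$ for all $r>0$ and $\theta\in\mathbb S^2$. -/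

import Mathlib

open MeasureTheory Set
open scoped ENNReal ContDiff

namespace EvansLewis

/-- Euclidean space `ℝ³`. -/
abbrev E3 : Type := EuclideanSpace ℝ (Fin 3)

/-- The unit sphere `S²` of `ℝ³`. -/
abbrev S2 : Type := Metric.sphere (0 : E3) 1

/-- The (unnormalised) surface measure of the unit sphere. -/
noncomputable abbrev surf : Measure S2 := (volume : Measure E3).toSphere

/-- The complex Hilbert space `L²(S²)`. -/
abbrev L2S2 : Type := Lp ℂ 2 surf

/-- The Rellich constant `Rₙ = n(n-4)/4`; so `R₃ = -3/4`. -/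
noncomputable def rellichConst (n : ℕ) : ℝ := (n : ℝ) * ((n : ℝ) - 4) / 4

section Operators

variable {H : Type*} [NormedAddCommGroup H] [InnerProductSpace ℂ H]

/-- `z` lies in the resolvent set of the unbounded operator `T`: the map `T - z` from the domain
of `T` to `H` has a bounded everywhere defined two-sided inverse `R`. -/
def InResolventSet (T : H →ₗ.[ℂ] H) (z : ℂ) : Prop :=
  ∃ R : H →L[ℂ] H,
    (∀ v : H, ∃ h : R v ∈ T.domain, T ⟨R v, h⟩ - z • R v = v) ∧
    (∀ u : T.domain, R (T u - z • (u : H)) = u)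

/-- The spectrum of an unbounded operator. -/
def opSpectrum (T : H →ₗ.[ℂ] H) : Set ℂ := {z | ¬ InResolventSet T z}

/-- The set of real eigenvalues of an unbounded operator. -/
def eigenvalueSet (T : H →ₗ.[ℂ] H) : Set ℝ :=
  {c | ∃ u : T.domain, (u : H) ≠ 0 ∧ T u = (c : ℂ) • (u : H)}

/-- `⟨T u, u⟩ ≥ 0` for all `u` in the domain of `T`. -/
def IsNonnegOp (T : H →ₗ.[ℂ] H) : Prop :=
  ∀ u : T.domain, 0 ≤ (inner ℂ (T u) (u : H)).re

/-- The spectrum consists of eigenvalues and has no finite accumulation point (every bounded part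
of it is finite). Infinite multiplicities are not excluded. -/
def HasDiscreteSpectrum (T : H →ₗ.[ℂ] H) : Prop :=
  (∀ z ∈ opSpectrum T, ∃ u : T.domain, (u : H) ≠ 0 ∧ T u = z • (u : H)) ∧
  (∀ M : ℝ, (opSpectrum T ∩ Metric.closedBall 0 M).Finite)

end Operators

/-- The three-dimensional radial Laplacian `Δ_r = ∂_r² + (2/|x|) ∂_r`, where `∂_r` is the
derivative along the ray through `x`. -/
noncomputable def radialLaplacian (f : E3 → ℂ) (x : E3) : ℂ :=
  iteratedDeriv 2 (fun t : ℝ => f (t • (‖x‖⁻¹ • x))) ‖x‖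
    + ((2 / ‖x‖ : ℝ) : ℂ) * deriv (fun t : ℝ => f (t • (‖x‖⁻¹ • x))) ‖x‖

/-- Admissible functions: measurable, vanishing near the origin and near infinity, `C²` along every
line through the origin, with second radial derivative dominated by a square integrable function of
the angle. Every function in `C_c^∞(ℝ³ \ {0})` is admissible (`IsAdmissible.of_contDiff`), and so is
every product of a function in `C_c^∞(0, ∞)` of `|x|` and an `L²` function of the angle. -/
structure IsAdmissible (f : E3 → ℂ) : Prop where
  measurable : Measurable f
  support : ∃ a b : ℝ, 0 < a ∧ ∀ x, f x ≠ 0 → a ≤ ‖x‖ ∧ ‖x‖ ≤ b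
  contDiff : ∀ θ : S2, ContDiff ℝ 2 (fun t : ℝ => f (t • (θ : E3)))
  dominated : ∃ G : S2 → ℝ, MemLp G 2 surf ∧
    ∀ (θ : S2) (r : ℝ), 0 < r → ‖iteratedDeriv 2 (fun t : ℝ => f (t • (θ : E3))) r‖ ≤ G θ

/-- `g = Λ f`, where the operator `Λ` of `L²(S²)` acts in the angular variable: for almost every
radius `r > 0` the restriction `f(r ·)` lies in the domain of `Λ`, and `Λ (f(r ·)) = g(r ·)`. -/
def IsAngularImage (L : L2S2 →ₗ.[ℂ] L2S2) (f g : E3 → ℂ) : Prop :=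
  AEStronglyMeasurable g volume ∧
  ∀ᵐ r : ℝ ∂(volume.restrict (Ioi 0)), ∃ u : L.domain,
    ((u : L2S2) : S2 → ℂ) =ᵐ[surf] (fun θ => f (r • (θ : E3))) ∧
    ((L u : L2S2) : S2 → ℂ) =ᵐ[surf] (fun θ => g (r • (θ : E3)))

/-- `c` is a nonzero eigenvalue of `T` that maximises `-R₃² (1/λ + 1/R₃)² + 1` among the nonzero
eigenvalues `λ` of `T`. -/
def IsMaximisingEigenvalue {H : Type*} [NormedAddCommGroup H] [InnerProductSpace ℂ H]
    (T : H →ₗ.[ℂ] H) (c : ℝ) : Prop :=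
  c ∈ eigenvalueSet T \ {0} ∧
  IsMaxOn (fun l : ℝ => -(rellichConst 3) ^ 2 * (1 / l + 1 / rellichConst 3) ^ 2 + 1)
    (eigenvalueSet T \ {0}) c

theorem exists_bound_iteratedDeriv_line {E : Type*} [NormedAddCommGroup E] [NormedSpace ℝ E]
    {f : E → ℂ} (h2 : ContDiff ℝ 2 f) (hc : HasCompactSupport f) :
    ∃ C : ℝ, ∀ v : E, ‖v‖ = 1 → ∀ r : ℝ, ‖iteratedDeriv 2 (fun t : ℝ => f (t • v)) r‖ ≤ C := by
  have hd1 : ContDiff ℝ 1 (fderiv ℝ f) := h2.fderiv_right (by norm_num)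
  have hcont : Continuous (fderiv ℝ (fderiv ℝ f)) := hd1.continuous_fderiv (by norm_num)
  have hbd : ∃ C : ℝ, ∀ x, ‖fderiv ℝ (fderiv ℝ f) x‖ ≤ C := by
    have hnorm : Continuous (fun x => ‖fderiv ℝ (fderiv ℝ f) x‖) :=
      (continuous_norm (E := E →L[ℝ] E →L[ℝ] ℂ)).comp hcont
    obtain ⟨C, hC⟩ := IsCompact.bddAbove_image (K := tsupport f) hc hnorm.continuousOn
    refine ⟨max C 0, fun x => ?_⟩
    by_cases hx : x ∈ tsupport f
    · exact (hC (mem_image_of_mem _ hx)).trans (le_max_left _ _)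
    · have h1 : x ∉ tsupport (fderiv ℝ (fderiv ℝ f)) := fun h =>
        hx (tsupport_fderiv_subset ℝ (tsupport_fderiv_subset ℝ h))
      rw [image_eq_zero_of_notMem_tsupport h1]
      exact (norm_zero (E := E →L[ℝ] E →L[ℝ] ℂ)).le.trans (le_max_right _ _)
  obtain ⟨C, hC⟩ := hbd
  refine ⟨C, fun v hv r => ?_⟩
  have hline : ∀ t : ℝ, HasDerivAt (fun t : ℝ => t • v) v t := fun t => by
    simpa using (hasDerivAt_id t).smul_const v
  have e1 : deriv (fun t : ℝ => f (t • v)) = fun t : ℝ => fderiv ℝ f (t • v) v := by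
    funext t
    exact (((h2.differentiable (by norm_num)) _).hasFDerivAt.comp_hasDerivAt t (hline t)).deriv
  have e2 : HasDerivAt (fun t : ℝ => fderiv ℝ f (t • v) v)
      (fderiv ℝ (fderiv ℝ f) (r • v) v v) r := by
    have := ((hd1.differentiable (by norm_num)) (r • v)).hasFDerivAt.comp_hasDerivAt r (hline r)
    simpa using this.clm_apply (hasDerivAt_const r v)
  rw [iteratedDeriv_succ, iteratedDeriv_one, e1, e2.deriv]
  calc _ ≤ ‖fderiv ℝ (fderiv ℝ f) (r • v)‖ * ‖v‖ * ‖v‖ := ContinuousLinearMap.le_opNorm₂ _ _ _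
    _ ≤ C := by rw [hv]; simpa using hC (r • v)

theorem IsAdmissible.of_contDiff {f : E3 → ℂ} (hf : ContDiff ℝ ∞ f) (hc : HasCompactSupport f)
    (h0 : (0 : E3) ∉ tsupport f) : IsAdmissible f := by
  have h2 : ContDiff ℝ 2 f := contDiff_infty.1 hf 2
  refine ⟨hf.continuous.measurable, ?_, ?_, ?_⟩
  · obtain ⟨a, ha, hball⟩ := Metric.isOpen_iff.1 (isClosed_tsupport f).isOpen_compl 0 h0
    obtain ⟨b, hb⟩ := hc.isBounded.exists_norm_le
    refine ⟨a, b, ha, fun x hx => ?_⟩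
    have hx' : x ∈ tsupport f := subset_tsupport f hx
    refine ⟨?_, hb x hx'⟩
    by_contra hlt
    exact hball (by simpa using hlt) hx'
  · intro θ
    exact h2.comp (contDiff_id.smul contDiff_const)
  · obtain ⟨C, hC⟩ := exists_bound_iteratedDeriv_line h2 hc
    have hmem : MemLp (fun _ : S2 => C) 2 surf := memLp_const C
    exact ⟨fun _ => C, hmem, fun θ r _ => hC θ (by simp) r⟩

end EvansLewis

/-! The operator `-L` has a Hilbert basis of eigenvectors with eigenvalues `l ≥ 0`, so expanding
`f(r ·)` in this basis decouples the inequality into one-dimensional inequalities for the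
coefficients `u(r)`. On each mode `L` acts as multiplication by `-l`.

For a single mode, the Rellich inequality `intervalIntegral_rellich_real` bounds `(l - 3/4)² ∫
|u|²/r²` by `∫ r² |u'' + (2/r)u' - (l/r²)u|²`. What has to be estimated is `l² ∫ |u|²/r²`, so the
loss on a mode with `l > 0` is the factor `(l/(l + R₃))²`. Since `-R₃²(1/l + 1/R₃)² + 1 = 1 - ((l +
R₃)/l)²`, a maximising eigenvalue is exactly one with the worst factor
(`IsMaximisingEigenvalue.sq_le`); the mode `l = 0` contributes nothing on the left. Polar
coordinates (`lintegral_polar`) and Parseval on almost every sphere then sum the modes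
(`rellich_of_hilbertBasis`), with all integrals taken in `[0, ∞]`, so that no finiteness is needed.

The basis comes from the bounded self-adjoint resolvent `R = (-L + 1)⁻¹`. Multiplicities may be
infinite, so `R` need not be compact. Its spectrum can accumulate only at `0`, however, and the
continuous functional calculus supplies the eigenprojections at nonzero points. -/

namespace EvansLewis

/-! ### Eigenvector bases from the resolvent at `-1`. -/

section Spectral

universe u

variable {H : Type u} [NormedAddCommGroup H] [InnerProductSpace ℂ H]

theorem ofReal_mem_opSpectrum_of_mem_eigenvalueSet {A : H →ₗ.[ℂ] H} {c : ℝ}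
    (hc : c ∈ eigenvalueSet A) : (c : ℂ) ∈ opSpectrum A := by
  rintro ⟨R, -, hR⟩
  obtain ⟨u, hu0, hu⟩ := hc
  have := hR u
  rw [hu, sub_self, map_zero] at this
  exact hu0 this.symm

theorem eigenvalueSet_nonneg {A : H →ₗ.[ℂ] H} (hA : IsNonnegOp A) {c : ℝ}
    (hc : c ∈ eigenvalueSet A) : 0 ≤ c := by
  obtain ⟨u, hu0, hu⟩ := hc
  have h := hA u
  rw [hu, inner_smul_left, inner_self_eq_norm_sq_to_K] at h
  have h2 : 0 ≤ c * ‖(u : H)‖ ^ 2 := by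
    convert h using 1
    simp [← Complex.ofReal_pow]
  exact nonneg_of_mul_nonneg_left h2 (by positivity)

theorem inResolventSet_neg_one {A : H →ₗ.[ℂ] H} (hA : IsNonnegOp A)
    (hd : HasDiscreteSpectrum A) : InResolventSet A (-1) := by
  by_contra h
  obtain ⟨u, hu0, hu⟩ := hd.1 (-1) h
  have : (-1 : ℝ) ∈ eigenvalueSet A := ⟨u, hu0, by simpa using hu⟩
  linarith [eigenvalueSet_nonneg hA this]

/-- Contrapositive: if `S` inverts `A - (m⁻¹ - 1)`, the resolvent identity `S - R = m⁻¹ S R = m⁻¹ R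
S` shows that `m⁻¹ (1 + m⁻¹ S)` inverts `m - R`. -/
theorem mem_opSpectrum_of_mem_spectrum_resolvent {A : H →ₗ.[ℂ] H} {R : H →L[ℂ] H}
    (hR : ∀ v : H, ∃ h : R v ∈ A.domain, A ⟨R v, h⟩ - (-1 : ℂ) • R v = v)
    (hR' : ∀ u : A.domain, R (A u - (-1 : ℂ) • (u : H)) = u) {m : ℂ} (hm : m ≠ 0)
    (hs : m ∈ spectrum ℂ R) : m⁻¹ - 1 ∈ opSpectrum A := by
  rintro ⟨S, hS, hS'⟩
  refine hs ?_
  have hres : ∀ v, S v = R v + m⁻¹ • S (R v) := by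
    intro v
    obtain ⟨h, e⟩ := hR v
    have := hS' ⟨R v, h⟩
    have e2 : A ⟨R v, h⟩ = v - R v := by
      rw [← sub_eq_zero, ← sub_eq_zero.2 e]; simp; abel
    simp only [e2, map_sub, map_smul, sub_smul, one_smul] at this
    rw [← sub_eq_zero] at this ⊢
    rw [← this]; abel
  have hres' : ∀ v, S v = R v + m⁻¹ • R (S v) := by
    intro v
    obtain ⟨h, e⟩ := hS v
    have := hR' ⟨S v, h⟩
    have e2 : A ⟨S v, h⟩ = v + (m⁻¹ - 1) • S v := sub_eq_iff_eq_add.1 e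
    simp only [e2, map_sub, map_add, map_smul, sub_smul, neg_smul, one_smul, map_neg] at this
    rw [← sub_eq_zero] at this ⊢
    rw [← neg_eq_zero, ← this]; abel
  refine ⟨⟨algebraMap ℂ _ m - R, m⁻¹ • (1 + m⁻¹ • S), ?_, ?_⟩, rfl⟩
  · ext v
    change m • (m⁻¹ • (v + m⁻¹ • S v)) - R (m⁻¹ • (v + m⁻¹ • S v)) = v
    simp only [map_smul, map_add, smul_inv_smul₀ hm]
    linear_combination (norm := module) m⁻¹ • hres' v
  · ext v
    change m⁻¹ • ((m • v - R v) + m⁻¹ • S (m • v - R v)) = v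
    simp only [map_smul, map_sub, smul_sub, smul_add, inv_smul_smul₀ hm]
    linear_combination (norm := module) m⁻¹ • hres v

variable [CompleteSpace H]

-- `S` can accumulate only at `0`, so the indicator of a nonzero point is locally constant on `S`.
-- This admits it to the continuous functional calculus.
open Classical in
theorem continuousOn_indicator_of_isolated {S : Set ℝ}
    (hS : ∀ ε : ℝ, 0 < ε → (S ∩ {t | ε ≤ |t|}).Finite) {m : ℝ} (hm : m ≠ 0) :
    ContinuousOn (fun t : ℝ => if t = m then (1 : ℝ) else 0) S := by
  intro s _
  by_cases hs : s = m
  · subst hs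
    have hpos : 0 < |s| := abs_pos.2 hm
    have hfin := (hS (|s| / 2) (by positivity)).subset
      (sdiff_subset : (S ∩ {t | |s| / 2 ≤ |t|}) \ {s} ⊆ _)
    have h1 : ((S ∩ {t | |s| / 2 ≤ |t|}) \ {s})ᶜ ∈ nhds s :=
      hfin.isClosed.isOpen_compl.mem_nhds (by simp)
    have h2 : {t : ℝ | |s| / 2 < |t|} ∈ nhds s :=
      (isOpen_lt continuous_const continuous_abs).mem_nhds (by simp [hpos])
    refine (continuousWithinAt_const (b := (1 : ℝ))).congr_of_eventuallyEq ?_ (by simp)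
    filter_upwards [nhdsWithin_le_nhds h1, nhdsWithin_le_nhds h2, self_mem_nhdsWithin]
      with t ht1 ht2 ht3
    by_cases hts : t = s
    · simp [hts]
    · exact absurd ⟨⟨ht3, le_of_lt ht2⟩, hts⟩ ht1
  · refine (continuousWithinAt_const (b := (0 : ℝ))).congr_of_eventuallyEq ?_ (by simp [hs])
    filter_upwards [nhdsWithin_le_nhds (isOpen_ne.mem_nhds hs)] with t ht
    simp [show t ≠ m from ht]

open Classical in
/-- If the nonzero part of the spectrum of a bounded self-adjoint operator is discrete, then a
vector orthogonal to all eigenvectors with nonzero eigenvalues lies in the kernel. -/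
theorem apply_eq_zero_of_orthogonal_eigenvectors {R : H →L[ℂ] H} (hR : IsSelfAdjoint R)
    (hfin : ∀ ε : ℝ, 0 < ε → (spectrum ℝ R ∩ {t | ε ≤ |t|}).Finite) {x : H}
    (hx : ∀ (m : ℝ) (v : H), m ≠ 0 → R v = (m : ℂ) • v → inner ℂ v x = 0) : R x = 0 := by
  -- The indicator of `{m}` applied to `R` is an orthogonal projection `P` with `R P = m P`. Thus `P
  -- x` satisfies the eigenvector equation, and `‖P x‖² = ⟨P x, x⟩ = 0`.
  have hP : ∀ m : ℝ, m ≠ 0 → cfc (fun t : ℝ => if t = m then (1 : ℝ) else 0) R x = 0 := by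
    intro m hm
    have hcont := continuousOn_indicator_of_isolated hfin hm
    set P := cfc (fun t : ℝ => if t = m then (1 : ℝ) else 0) R with hPdef
    have hPsa : IsSelfAdjoint P := cfc_predicate _ R
    have hPP : P * P = P := by
      rw [hPdef, ← cfc_mul _ _ R hcont hcont]
      congr 1
      funext t
      by_cases h : t = m <;> simp [h]
    have hRP : R * P = m • P := by
      conv_lhs => rw [← cfc_id' ℝ R]
      rw [hPdef, ← cfc_mul (fun t : ℝ => t) _ R continuousOn_id hcont, ← cfc_const_mul m _ R hcont]
      congr 1
      funext t
      by_cases h : t = m <;> simp [h]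
    have h1 : R (P x) = (m : ℂ) • P x := by
      have := congrArg (fun T : H →L[ℂ] H => T x) hRP
      simpa using this
    have h2 := hx m (P x) hm h1
    have h3 : inner ℂ (P x) (P x) = 0 := by
      have := hPsa.isSymmetric (P x) x
      have h4 : P (P x) = P x := congrArg (fun T : H →L[ℂ] H => T x) hPP
      simp only [ContinuousLinearMap.coe_coe, h4] at this
      rw [← this, h2]
    exact inner_self_eq_zero.1 h3
  have hle : ∀ ε : ℝ, 0 < ε → ‖R x‖ ≤ ε * ‖x‖ := by
    intro ε hε
    set F := (hfin ε hε).toFinset with hF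
    have hF0 : ∀ m ∈ F, m ≠ 0 := by
      intro m hm h0
      simp only [hF, Finite.mem_toFinset, mem_inter_iff, mem_ofPred_eq] at hm
      rw [h0, abs_zero] at hm
      linarith [hm.2]
    have hcont : ∀ m ∈ F, ContinuousOn (fun t : ℝ => m * if t = m then (1 : ℝ) else 0)
        (spectrum ℝ R) := fun m hm =>
      continuousOn_const.mul (continuousOn_indicator_of_isolated hfin (hF0 m hm))
    have hcs : ContinuousOn (∑ m ∈ F, fun t : ℝ => m * if t = m then (1 : ℝ) else 0)
        (spectrum ℝ R) := by
      rw [show (∑ m ∈ F, fun t : ℝ => m * if t = m then (1 : ℝ) else 0) =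
        fun t => ∑ m ∈ F, m * if t = m then (1 : ℝ) else 0 by ext; simp]
      exact continuousOn_finsetSum _ hcont
    have hsum : cfc (∑ m ∈ F, fun t : ℝ => m * if t = m then (1 : ℝ) else 0) R x = 0 := by
      rw [cfc_sum _ R F hcont, _root_.sum_apply]
      refine Finset.sum_eq_zero fun m hm => ?_
      rw [cfc_const_mul m _ R (continuousOn_indicator_of_isolated hfin (hF0 m hm))]
      simp [hP m (hF0 m hm)]
    -- Removing the finitely many spectral values of modulus at least `ε` leaves a function bounded
    -- by `ε` on the spectrum, and the removed part kills `x`.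
    have hnorm : ‖cfc (fun t : ℝ => t - (∑ m ∈ F, fun t : ℝ => m * if t = m then (1 : ℝ) else 0) t) R‖
        ≤ ε := by
      refine norm_cfc_le hε.le fun t ht => ?_
      by_cases hte : ε ≤ |t|
      · have : t ∈ F := by simp [hF, ht, hte]
        simp [Finset.sum_apply, this, hε.le]
      · have : t ∉ F := by simp [hF, hte]
        simp only [Finset.sum_apply, mul_ite, mul_one, mul_zero, Finset.sum_ite_eq, this, if_false,
          sub_zero, Real.norm_eq_abs]
        exact (not_le.1 hte).le
    rw [cfc_sub (fun t : ℝ => t) _ R continuousOn_id hcs, cfc_id' ℝ R] at hnorm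
    have := ContinuousLinearMap.le_of_opNorm_le _ hnorm x
    rwa [_root_.sub_apply, hsum, sub_zero] at this
  have : ‖R x‖ ≤ 0 := by
    refine le_of_forall_pos_le_add fun δ hδ => ?_
    have := hle (δ / (‖x‖ + 1)) (by positivity)
    refine this.trans ?_
    rw [zero_add, div_mul_eq_mul_div, div_le_iff₀ (by positivity)]
    nlinarith [norm_nonneg x]
  exact norm_le_zero_iff.1 this

theorem isSelfAdjoint_resolvent {A : H →ₗ.[ℂ] H} (hsym : A.IsFormalAdjoint A) {R : H →L[ℂ] H}
    (hR : ∀ v : H, ∃ h : R v ∈ A.domain, A ⟨R v, h⟩ - (-1 : ℂ) • R v = v) : IsSelfAdjoint R := by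
  rw [ContinuousLinearMap.isSelfAdjoint_iff_isSymmetric]
  intro x y
  obtain ⟨hx, ex⟩ := hR x
  obtain ⟨hy, ey⟩ := hR y
  have h := hsym ⟨R x, hx⟩ ⟨R y, hy⟩
  simp only [ContinuousLinearMap.coe_coe]
  have e1 : inner ℂ (R x) y = inner ℂ (R x) (A ⟨R y, hy⟩) + inner ℂ (R x) (R y) := by
    rw [← inner_add_right]
    congr 1
    simpa using ey.symm
  have e2 : inner ℂ x (R y) = inner ℂ (A ⟨R x, hx⟩) (R y) + inner ℂ (R x) (R y) := by
    rw [← inner_add_left]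
    congr 1
    simpa using ex.symm
  rw [e1, e2, h]

/-- The injection `t ↦ t⁻¹ - 1` carries this set into the part of the spectrum of `A` in the ball of
radius `ε⁻¹ + 1`, which is finite. -/
theorem finite_spectrum_resolvent {A : H →ₗ.[ℂ] H} (hd : HasDiscreteSpectrum A) {R : H →L[ℂ] H}
    (hR : ∀ v : H, ∃ h : R v ∈ A.domain, A ⟨R v, h⟩ - (-1 : ℂ) • R v = v)
    (hR' : ∀ u : A.domain, R (A u - (-1 : ℂ) • (u : H)) = u) (ε : ℝ) (hε : 0 < ε) :
    (spectrum ℝ R ∩ {t | ε ≤ |t|}).Finite := by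
  refine Set.Finite.of_finite_image (f := fun t : ℝ => ((t : ℂ))⁻¹ - 1)
    ((hd.2 (ε⁻¹ + 1)).subset ?_) ?_
  · rintro _ ⟨t, ⟨ht, hte⟩, rfl⟩
    have ht0 : t ≠ 0 := fun h => by
      simp only [mem_ofPred_eq, h, abs_zero] at hte
      linarith
    refine ⟨mem_opSpectrum_of_mem_spectrum_resolvent hR hR' (by exact_mod_cast ht0)
      ((spectrum.algebraMap_mem_iff ℂ).2 ht), ?_⟩
    simp only [mem_closedBall_zero_iff]
    refine (norm_sub_le _ _).trans ?_
    rw [norm_one, norm_inv, Complex.norm_real, Real.norm_eq_abs]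
    gcongr
    exact hte
  · intro s _ t _ h
    simpa using h

/-- A symmetric non-negative operator with discrete spectrum has a Hilbert basis of
eigenvectors. -/
theorem exists_hilbertBasis_eigenvectors {A : H →ₗ.[ℂ] H} (hsym : A.IsFormalAdjoint A)
    (hA : IsNonnegOp A) (hd : HasDiscreteSpectrum A) :
    ∃ (ι : Type u) (b : HilbertBasis ι ℂ H), ∀ i, ∃ c ∈ eigenvalueSet A,
      ∃ h : b i ∈ A.domain, A ⟨b i, h⟩ = (c : ℂ) • b i := by
  obtain ⟨R, hR, hR'⟩ := inResolventSet_neg_one hA hd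
  have hsa := isSelfAdjoint_resolvent hsym hR
  have hinj : ∀ v, R v = 0 → v = 0 := by
    intro v hv
    obtain ⟨h, e⟩ := hR v
    have h0 : (⟨R v, h⟩ : A.domain) = 0 := Subtype.ext hv
    rw [h0, LinearPMap.map_zero, hv] at e
    simpa using e.symm
  let V : ℝ → Submodule ℂ H := fun m => Module.End.eigenspace (R : H →ₗ[ℂ] H) (m : ℂ)
  have hmem : ∀ (m : ℝ) (v : H), v ∈ V m ↔ R v = (m : ℂ) • v := fun m v =>
    Module.End.mem_eigenspace_iff
  have hcomplete : ∀ m, CompleteSpace (V m) := fun m => by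
    have hcl : IsClosed {v : H | R v = (m : ℂ) • v} :=
      isClosed_eq R.continuous (continuous_const_smul _)
    have : ((V m : Submodule ℂ H) : Set H) = {v : H | R v = (m : ℂ) • v} := by
      ext v; exact hmem m v
    exact (show IsClosed ((V m : Submodule ℂ H) : Set H) by rw [this]; exact hcl).completeSpace_coe
  have horthfam : OrthogonalFamily ℂ (fun m => V m) fun m => (V m).subtypeₗᵢ :=
    hsa.isSymmetric.orthogonalFamily_eigenspaces.comp Complex.ofReal_injective
  -- The basis is the union over all real `m` of bases of the eigenspaces of `R`. A vector
  -- orthogonal to all of them is killed by `R`, hence zero by injectivity.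
  choose w b hb using fun m => exists_hilbertBasis ℂ (V m)
  have hort := horthfam.orthonormal_sigma_orthonormal (v_family := fun m => b m)
    fun m => (b m).orthonormal
  have horth : (Submodule.span ℂ (Set.range fun a : Σ m, w m =>
      (V a.1).subtypeₗᵢ (b a.1 a.2)))ᗮ = ⊥ := by
    rw [Submodule.eq_bot_iff]
    intro x hx
    refine hinj x (apply_eq_zero_of_orthogonal_eigenvectors hsa
      (finite_spectrum_resolvent hd hR hR') fun m v hm hv => ?_)
    have hsum := ((b m).hasSum_repr ⟨v, (hmem m v).2 hv⟩).mapL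
      ((innerSL ℂ x).comp (V m).subtypeL)
    have hzero : ∀ i, ((innerSL ℂ x).comp (V m).subtypeL)
        (((b m).repr ⟨v, (hmem m v).2 hv⟩ i) • b m i) = 0 := by
      intro i
      have : inner ℂ x ((b m i : V m) : H) = 0 :=
        (Submodule.mem_orthogonal' _ _).1 hx _ (Submodule.subset_span ⟨⟨m, i⟩, rfl⟩)
      simp [this]
    simp only [hzero] at hsum
    have h0 : inner ℂ x v = 0 := by simpa using hsum.unique hasSum_zero
    exact inner_eq_zero_symm.1 h0
  refine ⟨Σ m, w m, HilbertBasis.mkOfOrthogonalEqBot hort horth, fun ⟨m, i⟩ => ?_⟩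
  rw [HilbertBasis.coe_mkOfOrthogonalEqBot]
  set v : H := ((b m i : V m) : H) with hv
  change ∃ c ∈ eigenvalueSet A, ∃ h : v ∈ A.domain, A ⟨v, h⟩ = (c : ℂ) • v
  have hRv : R v = (m : ℂ) • v := (hmem m v).1 (b m i).2
  have hv0 : v ≠ 0 := by
    have := (b m).orthonormal.ne_zero i
    simpa [hv] using this
  have hm : (m : ℂ) ≠ 0 := fun h => hv0 (hinj v (by rw [hRv, h, zero_smul]))
  have hRm : R ((m : ℂ)⁻¹ • v) = v := by rw [map_smul, hRv, inv_smul_smul₀ hm]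
  obtain ⟨h, e⟩ := hR ((m : ℂ)⁻¹ • v)
  have hdom : v ∈ A.domain := hRm ▸ h
  have hsub : (⟨R ((m : ℂ)⁻¹ • v), h⟩ : A.domain) = ⟨v, hdom⟩ := Subtype.ext hRm
  rw [hsub, hRm] at e
  have hAv : A ⟨v, hdom⟩ = ((m⁻¹ - 1 : ℝ) : ℂ) • v := by
    push_cast
    rw [sub_smul, ← e]
    simp
  exact ⟨m⁻¹ - 1, ⟨⟨v, hdom⟩, hv0, hAv⟩, hdom, hAv⟩

end Spectral

/-! ### The maximising eigenvalue and the constant. -/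

section Eigenvalues

variable {H : Type*} [NormedAddCommGroup H] [InnerProductSpace ℂ H]

theorem rellichConst_three : rellichConst 3 = -(3 / 4) := by
  norm_num [rellichConst]

theorem finite_eigenvalueSet_inter_Icc {A : H →ₗ.[ℂ] H} (hd : HasDiscreteSpectrum A) (M : ℝ) :
    (eigenvalueSet A ∩ Icc 0 M).Finite := by
  refine Set.Finite.of_finite_image (f := fun t : ℝ => (t : ℂ)) ((hd.2 M).subset ?_)
    Complex.ofReal_injective.injOn
  rintro _ ⟨t, ⟨ht, ht0, htM⟩, rfl⟩
  exact ⟨ofReal_mem_opSpectrum_of_mem_eigenvalueSet ht, by simpa [abs_of_nonneg ht0] using htM⟩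

theorem exists_isMaximisingEigenvalue {A : H →ₗ.[ℂ] H} (hA : IsNonnegOp A)
    (hd : HasDiscreteSpectrum A) (hne : ∃ c ∈ eigenvalueSet A, c ≠ 0) :
    ∃ c, IsMaximisingEigenvalue A c := by
  set Φ : ℝ → ℝ := fun l => -(rellichConst 3) ^ 2 * (1 / l + 1 / rellichConst 3) ^ 2 + 1 with hΦ
  have hΦ' : ∀ l, 0 < l → Φ l = 3 / (2 * l) - 9 / (16 * l ^ 2) := by
    intro l hl
    simp only [hΦ, rellichConst_three]
    field_simp
    ring
  have hpos : ∀ l ∈ eigenvalueSet A \ {0}, 0 < l := fun l hl =>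
    (eigenvalueSet_nonneg hA hl.1).lt_of_ne' hl.2
  obtain ⟨M, l₁, hl₁, hl₁M, hM⟩ : ∃ M : ℝ, ∃ l₁ ∈ eigenvalueSet A \ {0}, l₁ ≤ M ∧
      ∀ l ∈ eigenvalueSet A \ {0}, M < l → Φ l ≤ Φ l₁ := by
    obtain ⟨c, hc, hc0⟩ := hne
    -- `3/8` is the zero of `Φ` on the positive axis. Beyond it `Φ` is positive and tends to `0` at
    -- infinity, so one eigenvalue there confines the search to a bounded interval.
    by_cases hbig : ∃ l ∈ eigenvalueSet A \ {0}, 3 / 8 < l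
    · obtain ⟨l₁, hl₁, h38⟩ := hbig
      have hl₁0 := hpos l₁ hl₁
      have hv : 0 < Φ l₁ := by
        rw [hΦ' l₁ hl₁0, sub_pos, div_lt_div_iff₀ (by positivity) (by positivity)]
        nlinarith
      -- Past this threshold `Φ l ≤ 3/(2l) ≤ Φ l₁`.
      refine ⟨max l₁ (3 / (2 * Φ l₁)), l₁, hl₁, le_max_left _ _, fun l hl hlt => ?_⟩
      have hl0 := hpos l hl
      have h1 : 3 / (2 * Φ l₁) < l := (le_max_right _ _).trans_lt hlt
      rw [hΦ' l hl0]
      have h2 : 3 / (2 * l) ≤ Φ l₁ := by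
        rw [div_lt_iff₀ (by positivity)] at h1
        rw [div_le_iff₀ (by positivity)]
        linarith
      have h3 : 0 ≤ 9 / (16 * l ^ 2) := by positivity
      linarith
    · push Not at hbig
      exact ⟨3 / 8, c, ⟨hc, hc0⟩, hbig c ⟨hc, hc0⟩, fun l hl h => absurd (hbig l hl) (not_le.2 h)⟩
  obtain ⟨c, hc, hmax⟩ := Set.exists_max_image ((eigenvalueSet A \ {0}) ∩ Iic M) Φ
    ((finite_eigenvalueSet_inter_Icc hd M).subset
      fun l hl => ⟨hl.1.1, (hpos l hl.1).le, hl.2⟩) ⟨l₁, hl₁, hl₁M⟩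
  refine ⟨c, hc.1, fun l hl => ?_⟩
  rcases le_or_gt l M with h | h
  · exact hmax l ⟨hl, h⟩
  · exact (hM l hl h).trans (hmax l₁ ⟨hl₁, hl₁M⟩)

/-- Maximality of `c` means that `((l - 3/4)/l)²` is smallest at `l = c`. In particular `c ≠ 3/4`
rules out `3/4` as an eigenvalue, since there this quantity would vanish. -/
theorem IsMaximisingEigenvalue.sq_le {A : H →ₗ.[ℂ] H} (hA : IsNonnegOp A) {c : ℝ}
    (hc : IsMaximisingEigenvalue A c) (hcR : c + rellichConst 3 ≠ 0) {l : ℝ}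
    (hl : l ∈ eigenvalueSet A) :
    l ^ 2 ≤ (c / (c + rellichConst 3)) ^ 2 * (l - 3 / 4) ^ 2 := by
  by_cases hl0 : l = 0
  · subst hl0
    have : (0 : ℝ) ≤ (c / (c + rellichConst 3)) ^ 2 * (0 - 3 / 4) ^ 2 := by positivity
    simpa using this
  have hlpos : 0 < l := (eigenvalueSet_nonneg hA hl).lt_of_ne' hl0
  have hcpos : 0 < c := (eigenvalueSet_nonneg hA hc.1.1).lt_of_ne' hc.1.2
  have h := hc.2 (show l ∈ eigenvalueSet A \ {0} from ⟨hl, hl0⟩)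
  simp only [mem_ofPred_eq, rellichConst_three] at h hcR ⊢
  have h1 : (1 / c - 4 / 3) ^ 2 ≤ (1 / l - 4 / 3) ^ 2 := by
    norm_num at h ⊢
    have e : ∀ t : ℝ, t - 4 / 3 = t + -(4 / 3) := fun t => by ring
    rw [e, e]
    linarith
  have h2 : ((c - 3 / 4) / c) ^ 2 ≤ ((l - 3 / 4) / l) ^ 2 := by
    have e : ∀ t : ℝ, 0 < t → ((t - 3 / 4) / t) ^ 2 = 9 / 16 * (1 / t - 4 / 3) ^ 2 := by
      intro t ht
      field_simp
      ring
    rw [e c hcpos, e l hlpos]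
    linarith
  have hc' : 0 < (c + -(3 / 4)) ^ 2 := by positivity
  rw [div_pow, div_pow, div_le_div_iff₀ (by positivity) (by positivity)] at h2
  rw [div_pow, div_mul_eq_mul_div, le_div_iff₀ hc']
  linarith

/-- Orthonormal vectors lie at distance `√2`, so balls of radius `1/2` around them are disjoint.
Countability is needed to exchange the sum over modes with the radial integral. -/
theorem countable_of_orthonormal [TopologicalSpace.SeparableSpace H] {ι : Type*} {v : ι → H}
    (hv : Orthonormal ℂ v) : Countable ι := by
  have hdist : ∀ i j, i ≠ j → 1 < dist (v i) (v j) := by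
    intro i j hij
    have h1 : ‖v i - v j‖ ^ 2 = 2 := by
      rw [@norm_sub_sq ℂ, hv.2 hij, hv.1 i, hv.1 j]
      norm_num
    rw [dist_eq_norm]
    nlinarith [norm_nonneg (v i - v j)]
  have hdisj : Pairwise (Function.onFun Disjoint fun i => Metric.ball (v i) (1 / 2)) := by
    intro i j hij
    exact Metric.ball_disjoint_ball (by linarith [hdist i j hij])
  have := Set.PairwiseDisjoint.countable_of_isOpen (a := (univ : Set ι))
    (s := fun i => Metric.ball (v i) (1 / 2)) (fun i _ j _ hij => hdisj hij)
    (fun i _ => Metric.isOpen_ball) (fun i _ => ⟨v i, by simp⟩)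
  exact countable_univ_iff.1 this

end Eigenvalues

/-! ### The one-dimensional Rellich inequality. -/

section RadialInequality

/-- One-dimensional Rellich inequality for the operator `∂_r² + (2/r) ∂_r - l/r²`. -/
theorem intervalIntegral_rellich_real {x x1 x2 : ℝ → ℝ} {a b l : ℝ} (ha : 0 < a) (hab : a ≤ b)
    (hl : 0 ≤ l) (h1 : ∀ r, 0 < r → HasDerivAt x (x1 r) r)
    (h2 : ∀ r, 0 < r → HasDerivAt x1 (x2 r) r) (h2c : ContinuousOn x2 (Ioi 0))
    (hxa : x a = 0) (hx1a : x1 a = 0) (hxb : x b = 0) (hx1b : x1 b = 0) :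
    (l - 3 / 4) ^ 2 * ∫ r in a..b, x r ^ 2 / r ^ 2 ≤
      ∫ r in a..b, r ^ 2 * (x2 r + 2 / r * x1 r - l / r ^ 2 * x r) ^ 2 := by
  have hsub : uIcc a b ⊆ Ioi 0 := fun r hr => by
    rw [uIcc_of_le hab] at hr
    exact ha.trans_le hr.1
  have hx : ContinuousOn x (uIcc a b) := fun r hr => (h1 r (hsub hr)).continuousAt.continuousWithinAt
  have hx1 : ContinuousOn x1 (uIcc a b) := fun r hr =>
    (h2 r (hsub hr)).continuousAt.continuousWithinAt
  have hx2 : ContinuousOn x2 (uIcc a b) := h2c.mono hsub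
  have hne : ∀ r ∈ uIcc a b, r ≠ 0 := fun r hr => (hsub hr).ne'
  have hne2 : ∀ r ∈ uIcc a b, r ^ 2 ≠ 0 := fun r hr => pow_ne_zero 2 (hne r hr)
  -- `Q'` is the derivative of `2r x'² - (2 + 2m) x x' + (1/2 - m) x²/r`, which vanishes at both
  -- endpoints, so its integral is zero.
  set m := l - 3 / 4 with hm
  set Q' : ℝ → ℝ := fun r => 2 * x1 r ^ 2 + 4 * r * x1 r * x2 r
    - (2 + 2 * m) * (x1 r ^ 2 + x r * x2 r) + (1 / 2 - m) * (2 * x r * x1 r / r - x r ^ 2 / r ^ 2)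
    with hQ'
  have hQc : ContinuousOn Q' (uIcc a b) := by
    simp only [hQ']
    fun_prop (disch := assumption)
  have hQint : ∫ r in a..b, Q' r = 0 := by
    have hderiv : ∀ r ∈ uIcc a b, HasDerivAt (fun r => 2 * (r * x1 r ^ 2)
        - (2 + 2 * m) * (x r * x1 r) + (1 / 2 - m) * (x r ^ 2 / r)) (Q' r) r := by
      intro r hr
      have d1 := h1 r (hsub hr)
      have d2 := h2 r (hsub hr)
      have hr0 := hne r hr
      convert! ((((hasDerivAt_id r).mul (d2.pow 2)).const_mul 2).sub
        ((d1.mul d2).const_mul (2 + 2 * m))).add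
        (((d1.pow 2).div (hasDerivAt_id r) hr0).const_mul (1 / 2 - m)) using 1
      simp only [hQ', id]
      field_simp
      simp
      ring
    rw [intervalIntegral.integral_eq_sub_of_hasDerivAt hderiv hQc.intervalIntegrable]
    simp [hxa, hx1a, hxb, hx1b]
  have hc1 : ContinuousOn (fun r => m ^ 2 * (x r ^ 2 / r ^ 2)) (uIcc a b) := by
    fun_prop (disch := assumption)
  have hc2 : ContinuousOn (fun r => r ^ 2 * (x2 r + 2 / r * x1 r - l / r ^ 2 * x r) ^ 2)
      (uIcc a b) := by
    fun_prop (disch := assumption)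
  rw [← intervalIntegral.integral_const_mul, ← add_zero (∫ r in a..b, _), ← hQint,
    ← intervalIntegral.integral_add hc1.intervalIntegrable hQc.intervalIntegrable]
  refine intervalIntegral.integral_mono_on hab (hc1.add hQc).intervalIntegrable
    hc2.intervalIntegrable fun r hr => ?_
  have hr0 : r ≠ 0 := (ha.trans_le hr.1).ne'
  -- Completing squares around the formal extremal `x = √r`: both squares vanish on it, and the
  -- radial operator multiplies it by `-(l - 3/4)/r²`. The coefficient `4 + 2m = 2l + 5/2` is
  -- positive because `l ≥ 0`.
  have key : r ^ 2 * (x2 r + 2 / r * x1 r - l / r ^ 2 * x r) ^ 2 =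
      m ^ 2 * (x r ^ 2 / r ^ 2) + Q' r + ((r * x2 r + x r / (4 * r)) ^ 2
        + (4 + 2 * m) * (x1 r - x r / (2 * r)) ^ 2) := by
    simp only [hQ', hm]
    field_simp
    ring
  rw [key]
  have : 0 ≤ 4 + 2 * m := by rw [hm]; linarith
  have : 0 ≤ (r * x2 r + x r / (4 * r)) ^ 2 + (4 + 2 * m) * (x1 r - x r / (2 * r)) ^ 2 := by
    positivity
  linarith

theorem lintegral_rellich {u u1 u2 : ℝ → ℂ} {a b l K : ℝ} (ha : 0 < a) (hab : a ≤ b)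
    (hl : 0 ≤ l) (hK : 0 ≤ K) (hlK : l ^ 2 ≤ K * (l - 3 / 4) ^ 2)
    (h1 : ∀ r, 0 < r → HasDerivAt u (u1 r) r)
    (h2 : ∀ r, 0 < r → HasDerivAt u1 (u2 r) r) (h2c : ContinuousOn u2 (Ioi 0))
    (hua : u a = 0) (hu1a : u1 a = 0) (hub : u b = 0) (hu1b : u1 b = 0)
    (hsupp : ∀ r, 0 < r → r ∉ Ioc a b → u r = 0) :
    ∫⁻ r in Ioi (0 : ℝ), ENNReal.ofReal (r ^ 2) * ‖((l / r ^ 2 : ℝ) : ℂ) * u r‖ₑ ^ 2 ≤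
      ENNReal.ofReal K * ∫⁻ r in Ioi (0 : ℝ), ENNReal.ofReal (r ^ 2) *
        ‖u2 r + ((2 / r : ℝ) : ℂ) * u1 r - ((l / r ^ 2 : ℝ) : ℂ) * u r‖ₑ ^ 2 := by
  have hIoc : Ioc a b ⊆ Ioi 0 := fun r hr => ha.trans hr.1
  have hsub : uIcc a b ⊆ Ioi 0 := fun r hr => by
    rw [uIcc_of_le hab] at hr
    exact ha.trans_le hr.1
  have hconv : ∀ (r : ℝ) (z : ℂ), ENNReal.ofReal (r ^ 2) * ‖z‖ₑ ^ 2 =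
      ENNReal.ofReal (r ^ 2 * (z.re ^ 2 + z.im ^ 2)) := by
    intro r z
    rw [ENNReal.ofReal_mul (sq_nonneg r), ← ofReal_norm, ← ENNReal.ofReal_pow (norm_nonneg z),
      ← Complex.normSq_eq_norm_sq, Complex.normSq_apply]
    ring_nf
  have hu : ContinuousOn u (uIcc a b) := fun r hr => (h1 r (hsub hr)).continuousAt.continuousWithinAt
  have hu1 : ContinuousOn u1 (uIcc a b) := fun r hr =>
    (h2 r (hsub hr)).continuousAt.continuousWithinAt
  have hu2 : ContinuousOn u2 (uIcc a b) := h2c.mono hsub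
  have hne : ∀ r ∈ uIcc a b, r ≠ 0 := fun r hr => (hsub hr).ne'
  have hne2 : ∀ r ∈ uIcc a b, r ^ 2 ≠ 0 := fun r hr => pow_ne_zero 2 (hne r hr)
  have hre : ContinuousOn (fun r => (u r).re) (uIcc a b) := Complex.continuous_re.comp_continuousOn hu
  have him : ContinuousOn (fun r => (u r).im) (uIcc a b) := Complex.continuous_im.comp_continuousOn hu
  have hre1 : ContinuousOn (fun r => (u1 r).re) (uIcc a b) :=
    Complex.continuous_re.comp_continuousOn hu1
  have him1 : ContinuousOn (fun r => (u1 r).im) (uIcc a b) :=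
    Complex.continuous_im.comp_continuousOn hu1
  have hre2 : ContinuousOn (fun r => (u2 r).re) (uIcc a b) :=
    Complex.continuous_re.comp_continuousOn hu2
  have him2 : ContinuousOn (fun r => (u2 r).im) (uIcc a b) :=
    Complex.continuous_im.comp_continuousOn hu2
  set F : ℝ → ℝ := fun r => l ^ 2 * ((u r).re ^ 2 / r ^ 2) + l ^ 2 * ((u r).im ^ 2 / r ^ 2) with hF
  set Gre : ℝ → ℝ := fun r =>
    r ^ 2 * ((u2 r).re + 2 / r * (u1 r).re - l / r ^ 2 * (u r).re) ^ 2 with hGre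
  set Gim : ℝ → ℝ := fun r =>
    r ^ 2 * ((u2 r).im + 2 / r * (u1 r).im - l / r ^ 2 * (u r).im) ^ 2 with hGim
  have hFc1 : ContinuousOn (fun r => (u r).re ^ 2 / r ^ 2) (uIcc a b) := by
    fun_prop (disch := assumption)
  have hFc2 : ContinuousOn (fun r => (u r).im ^ 2 / r ^ 2) (uIcc a b) := by
    fun_prop (disch := assumption)
  have hGc1 : ContinuousOn Gre (uIcc a b) := by
    simp only [hGre]
    fun_prop (disch := assumption)
  have hGc2 : ContinuousOn Gim (uIcc a b) := by
    simp only [hGim]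
    fun_prop (disch := assumption)
  have hFi : IntervalIntegrable F volume a b :=
    ((hFc1.const_smul (l ^ 2)).add (hFc2.const_smul (l ^ 2))).intervalIntegrable
  have hGi : IntervalIntegrable (fun r => Gre r + Gim r) volume a b :=
    (hGc1.add hGc2).intervalIntegrable
  -- The radial operator has real coefficients, so real and imaginary parts are treated separately.
  have hreal : ∫ r in a..b, F r ≤ K * ∫ r in a..b, (Gre r + Gim r) := by
    have e1 := intervalIntegral_rellich_real (x := fun r => (u r).re) (x1 := fun r => (u1 r).re)
      (x2 := fun r => (u2 r).re) ha hab hl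
      (fun r hr => Complex.reCLM.hasFDerivAt.comp_hasDerivAt r (h1 r hr))
      (fun r hr => Complex.reCLM.hasFDerivAt.comp_hasDerivAt r (h2 r hr))
      (Complex.continuous_re.comp_continuousOn h2c) (by simp [hua]) (by simp [hu1a])
      (by simp [hub]) (by simp [hu1b])
    have e2 := intervalIntegral_rellich_real (x := fun r => (u r).im) (x1 := fun r => (u1 r).im)
      (x2 := fun r => (u2 r).im) ha hab hl
      (fun r hr => Complex.imCLM.hasFDerivAt.comp_hasDerivAt r (h1 r hr))
      (fun r hr => Complex.imCLM.hasFDerivAt.comp_hasDerivAt r (h2 r hr))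
      (Complex.continuous_im.comp_continuousOn h2c) (by simp [hua]) (by simp [hu1a])
      (by simp [hub]) (by simp [hu1b])
    have n1 : 0 ≤ ∫ r in a..b, (u r).re ^ 2 / r ^ 2 :=
      intervalIntegral.integral_nonneg hab fun r _ => by positivity
    have n2 : 0 ≤ ∫ r in a..b, (u r).im ^ 2 / r ^ 2 :=
      intervalIntegral.integral_nonneg hab fun r _ => by positivity
    rw [intervalIntegral.integral_add (hFc1.intervalIntegrable.const_mul _)
      (hFc2.intervalIntegrable.const_mul _), intervalIntegral.integral_const_mul,
      intervalIntegral.integral_const_mul,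
      intervalIntegral.integral_add hGc1.intervalIntegrable hGc2.intervalIntegrable, mul_add]
    have f1 := mul_le_mul_of_nonneg_right hlK n1
    have f2 := mul_le_mul_of_nonneg_right hlK n2
    have g1 := mul_le_mul_of_nonneg_left e1 hK
    have g2 := mul_le_mul_of_nonneg_left e2 hK
    simp only [hGre, hGim]
    linarith
  calc _ = ∫⁻ r in Ioc a b, ENNReal.ofReal (F r) := by
        have hcongr : EqOn (fun r => ENNReal.ofReal (r ^ 2) * ‖((l / r ^ 2 : ℝ) : ℂ) * u r‖ₑ ^ 2)
            ((Ioc a b).indicator fun r => ENNReal.ofReal (F r)) (Ioi 0) := by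
          intro r hr
          have hr0 : r ≠ 0 := (mem_Ioi.1 hr).ne'
          by_cases hrm : r ∈ Ioc a b
          · simp only [indicator_of_mem hrm, hconv, hF, Complex.re_ofReal_mul,
              Complex.im_ofReal_mul]
            congr 1
            field_simp
          · simp [indicator_of_notMem hrm, hsupp r hr hrm]
        rw [setLIntegral_congr_fun measurableSet_Ioi hcongr, lintegral_indicator measurableSet_Ioc,
          Measure.restrict_restrict measurableSet_Ioc, inter_eq_self_of_subset_left hIoc]
    _ = ENNReal.ofReal (∫ r in a..b, F r) := by
        rw [intervalIntegral.integral_of_le hab, ofReal_integral_eq_lintegral_ofReal hFi.1]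
        exact Filter.Eventually.of_forall fun r => by simp only [hF, Pi.zero_apply]; positivity
    _ ≤ ENNReal.ofReal K * ENNReal.ofReal (∫ r in a..b, (Gre r + Gim r)) := by
        rw [← ENNReal.ofReal_mul hK]
        exact ENNReal.ofReal_le_ofReal hreal
    _ = ENNReal.ofReal K * ∫⁻ r in Ioc a b, ENNReal.ofReal (Gre r + Gim r) := by
        rw [intervalIntegral.integral_of_le hab, ofReal_integral_eq_lintegral_ofReal hGi.1]
        exact Filter.Eventually.of_forall fun r => by
          simp only [hGre, hGim, Pi.zero_apply]; positivity
    _ = ENNReal.ofReal K * ∫⁻ r in Ioc a b, ENNReal.ofReal (r ^ 2) *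
        ‖u2 r + ((2 / r : ℝ) : ℂ) * u1 r - ((l / r ^ 2 : ℝ) : ℂ) * u r‖ₑ ^ 2 := by
        congr 2
        funext r
        rw [hconv]
        simp only [hGre, hGim, Complex.sub_re, Complex.add_re, Complex.re_ofReal_mul,
          Complex.sub_im, Complex.add_im, Complex.im_ofReal_mul, mul_add]
    _ ≤ _ := by
        gcongr

end RadialInequality

/-! ### Polar coordinates, measurability and bounds for radial derivatives. -/

section Polar

/-- Integration in polar coordinates of `ℝ³`. -/
theorem lintegral_polar {F : E3 → ℝ≥0∞} (hF : AEMeasurable F volume) :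
    ∫⁻ x, F x = ∫⁻ r in Ioi (0 : ℝ), ENNReal.ofReal (r ^ 2) *
      ∫⁻ θ, F (r • (θ : E3)) ∂surf := by
  have hmp := (volume : Measure E3).measurePreserving_homeomorphUnitSphereProd
  have hdim : Module.finrank ℝ E3 - 1 = 2 := by simp
  rw [hdim] at hmp
  set e := homeomorphUnitSphereProd E3 with he
  have hsymm : MeasurePreserving e.toMeasurableEquiv.symm
      (surf.prod (Measure.volumeIoiPow 2)) (Measure.comap Subtype.val volume) :=
    MeasurePreserving.symm e.toMeasurableEquiv hmp
  have hm : MeasurableSet ({0}ᶜ : Set E3) := (measurableSet_singleton 0).compl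
  have hFs : AEMeasurable (fun y : ({0}ᶜ : Set E3) => F y) (Measure.comap Subtype.val volume) :=
    (hF.mono_measure Measure.restrict_le_self).comp_quasiMeasurePreserving
      (measurePreserving_subtype_coe hm).quasiMeasurePreserving
  have hFp : AEMeasurable (fun p : S2 × Ioi (0 : ℝ) => F ((p.2 : ℝ) • (p.1 : E3)))
      (surf.prod (Measure.volumeIoiPow 2)) :=
    hFs.comp_quasiMeasurePreserving hsymm.quasiMeasurePreserving
  calc ∫⁻ x, F x = ∫⁻ x in ({0}ᶜ : Set E3), F x := by
        rw [Measure.restrict_eq_self_of_ae_mem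
          (show ∀ᵐ x : E3, x ∈ ({0}ᶜ : Set E3) from compl_mem_ae_iff.2 (measure_singleton 0))]
    _ = ∫⁻ y : ({0}ᶜ : Set E3), F y ∂(Measure.comap Subtype.val volume) :=
        (lintegral_subtype_comap hm F).symm
    _ = ∫⁻ p, F ((p.2 : ℝ) • (p.1 : E3)) ∂(surf.prod (Measure.volumeIoiPow 2)) :=
        (hsymm.lintegral_comp_emb (MeasurableEquiv.measurableEmbedding _)
          (fun y : ({0}ᶜ : Set E3) => F y)).symm
    _ = ∫⁻ r, ∫⁻ θ, F ((r : ℝ) • (θ : E3)) ∂surf ∂(Measure.volumeIoiPow 2) :=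
        lintegral_prod_symm _ hFp
    _ = ∫⁻ r : Ioi (0 : ℝ), ENNReal.ofReal ((r : ℝ) ^ 2) *
          ∫⁻ θ, F ((r : ℝ) • (θ : E3)) ∂surf ∂(Measure.comap Subtype.val volume) := by
        rw [Measure.volumeIoiPow, lintegral_withDensity_eq_lintegral_mul_non_measurable _
          (by fun_prop) (Filter.Eventually.of_forall fun r => ENNReal.ofReal_lt_top)]
        rfl
    _ = _ := lintegral_subtype_comap measurableSet_Ioi fun r : ℝ => ENNReal.ofReal (r ^ 2) *
          ∫⁻ θ, F (r • (θ : E3)) ∂surf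

/-- The derivative is the pointwise limit of the difference quotients with step `1/(n+1)`, each
jointly measurable. -/
theorem measurable_uncurry_deriv {X : Type*} [MeasurableSpace X] {φ : ℝ → X → ℂ}
    (hφ : Measurable (Function.uncurry φ)) (hd : ∀ x, Differentiable ℝ fun t => φ t x) :
    Measurable (Function.uncurry fun t x => deriv (fun s => φ s x) t) := by
  refine measurable_of_tendsto_metrizable (f := fun (n : ℕ) (p : ℝ × X) =>
    ((1 / ((n : ℝ) + 1))⁻¹ : ℝ) • (φ (p.1 + 1 / ((n : ℝ) + 1)) p.2 - φ p.1 p.2)) (fun n => ?_) ?_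
  · have h1 : Measurable fun p : ℝ × X => φ (p.1 + 1 / ((n : ℝ) + 1)) p.2 :=
      hφ.comp (f := fun p : ℝ × X => (p.1 + 1 / ((n : ℝ) + 1), p.2)) (by fun_prop)
    exact Measurable.const_smul (h1.sub hφ) ((1 / ((n : ℝ) + 1))⁻¹)
  · rw [tendsto_pi_nhds]
    rintro ⟨t, x⟩
    have h := hasDerivAt_iff_tendsto_slope_zero.1 ((hd x) t).hasDerivAt
    refine h.comp (tendsto_nhdsWithin_iff.2 ⟨tendsto_one_div_add_atTop_nhds_zero_nat,
      Filter.Eventually.of_forall fun n => ?_⟩)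
    simp only [mem_compl_iff, mem_singleton_iff]
    positivity

theorem measurable_uncurry_iteratedDeriv_two {X : Type*} [MeasurableSpace X] {φ : ℝ → X → ℂ}
    (hφ : Measurable (Function.uncurry φ)) (hd : ∀ x, ContDiff ℝ 2 fun t => φ t x) :
    Measurable (Function.uncurry fun t x => iteratedDeriv 2 (fun s => φ s x) t) := by
  simp only [iteratedDeriv_succ, iteratedDeriv_zero]
  refine measurable_uncurry_deriv (φ := fun t x => deriv (fun s => φ s x) t)
    (measurable_uncurry_deriv hφ fun x => (hd x).differentiable (by norm_num)) fun x => ?_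
  have := (hd x).differentiable_iteratedDeriv 1 (by norm_num)
  rwa [iteratedDeriv_one] at this

theorem IsAdmissible.measurable_radialLaplacian {f : E3 → ℂ} (hf : IsAdmissible f) :
    Measurable (radialLaplacian f) := by
  set φ : ℝ → E3 → ℂ := fun t x => f (t • (‖x‖⁻¹ • x)) with hφdef
  have hφ : Measurable (Function.uncurry φ) := by
    refine hf.measurable.comp (f := fun p : ℝ × E3 => p.1 • (‖p.2‖⁻¹ • p.2)) ?_
    fun_prop
  have hd : ∀ x, ContDiff ℝ 2 fun t => φ t x := by
    intro x
    by_cases hx : x = 0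
    · simp only [hφdef, hx, smul_zero]
      exact contDiff_const
    · exact hf.contDiff ⟨‖x‖⁻¹ • x, by simp [norm_smul, hx]⟩
  have h1 := (measurable_uncurry_deriv hφ fun x => (hd x).differentiable (by norm_num)).comp
    (f := fun x : E3 => (‖x‖, x)) (by fun_prop)
  have h2 := (measurable_uncurry_iteratedDeriv_two hφ hd).comp
    (f := fun x : E3 => (‖x‖, x)) (by fun_prop)
  refine h2.add (Measurable.mul ?_ h1)
  fun_prop

theorem radialLaplacian_smul {f : E3 → ℂ} (θ : S2) {r : ℝ} (hr : 0 < r) :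
    radialLaplacian f (r • (θ : E3)) = iteratedDeriv 2 (fun t : ℝ => f (t • (θ : E3))) r
      + ((2 / r : ℝ) : ℂ) * deriv (fun t : ℝ => f (t • (θ : E3))) r := by
  have hn : ‖r • (θ : E3)‖ = r := by simp [norm_smul, abs_of_pos hr]
  have hv : ‖r • (θ : E3)‖⁻¹ • r • (θ : E3) = θ := by
    rw [hn, inv_smul_smul₀ hr.ne']
  rw [radialLaplacian, hv, hn]

/-- The radial derivatives of an admissible function vanish off a common shell, and are bounded by
a common square integrable function of the angle. -/
theorem IsAdmissible.exists_bounds {f : E3 → ℂ} (hf : IsAdmissible f) :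
    ∃ (a b : ℝ) (G : S2 → ℝ), 0 < a ∧ a ≤ b ∧ MemLp G 2 surf ∧ ∀ (θ : S2) (r : ℝ), 0 < r →
      ‖f (r • (θ : E3))‖ ≤ G θ ∧ ‖deriv (fun t : ℝ => f (t • (θ : E3))) r‖ ≤ G θ ∧
      ‖iteratedDeriv 2 (fun t : ℝ => f (t • (θ : E3))) r‖ ≤ G θ ∧
      (r ∉ Ioo a b → f (r • (θ : E3)) = 0 ∧ deriv (fun t : ℝ => f (t • (θ : E3))) r = 0) := by
  obtain ⟨a, b, ha, hab⟩ := hf.support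
  obtain ⟨G, hG, hbd⟩ := hf.dominated
  -- `f` and its radial derivative vanish at radius `B`, so the mean value inequality, applied twice
  -- from `B` inwards, turns the bound `G` on the second derivative into `G B` and `G B²`. The
  -- maximum keeps `B` positive when the shell is empty.
  set B := max a b + 1 with hB
  have haB : a ≤ B := (le_max_left a b).trans (by linarith)
  have hbB : b < B := (le_max_right a b).trans_lt (by linarith)
  have hB0 : 0 < B := ha.trans_le haB
  have hzero : ∀ (θ : S2) (r : ℝ), 0 < r → r ∉ Icc a b → f (r • (θ : E3)) = 0 := by
    intro θ r hr hrm
    by_contra h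
    have := hab _ h
    rw [norm_smul, Real.norm_eq_abs, abs_of_pos hr, norm_eq_of_mem_sphere, mul_one] at this
    exact hrm this
  have hzero' : ∀ (θ : S2) (r : ℝ), 0 < r → r ∉ Icc a b →
      deriv (fun t : ℝ => f (t • (θ : E3))) r = 0 := by
    intro θ r hr hrm
    have : (fun t : ℝ => f (t • (θ : E3))) =ᶠ[nhds r] fun _ => 0 := by
      filter_upwards [Ioi_mem_nhds hr, isClosed_Icc.isOpen_compl.mem_nhds hrm] with t ht htm
      exact hzero θ t ht htm
    rw [this.deriv_eq, deriv_const]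
  have hBm : B ∉ Icc a b := fun h => absurd h.2 (not_le.2 hbB)
  have hG0 : ∀ θ, 0 ≤ G θ := fun θ => (norm_nonneg _).trans (hbd θ 1 one_pos)
  have hd1 : ∀ θ : S2, Differentiable ℝ fun t : ℝ => f (t • (θ : E3)) := fun θ =>
    (hf.contDiff θ).differentiable (by norm_num)
  have hd2 : ∀ θ : S2, Differentiable ℝ (deriv fun t : ℝ => f (t • (θ : E3))) := fun θ => by
    have := (hf.contDiff θ).differentiable_iteratedDeriv 1 (by norm_num)
    rwa [iteratedDeriv_one] at this
  have hb1 : ∀ (θ : S2) (r : ℝ), 0 < r →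
      ‖deriv (fun t : ℝ => f (t • (θ : E3))) r‖ ≤ G θ * B := by
    intro θ r hr
    by_cases hrB : r ≤ B
    · have := (convex_Ioi (0 : ℝ)).norm_image_sub_le_of_norm_deriv_le
        (f := deriv fun t : ℝ => f (t • (θ : E3))) (C := G θ) (x := B) (y := r)
        (fun t _ => (hd2 θ) t) (fun t ht => ?_) hB0 hr
      · rw [hzero' θ B hB0 hBm, sub_zero] at this
        refine this.trans (mul_le_mul_of_nonneg_left ?_ (hG0 θ))
        rw [Real.norm_eq_abs, abs_sub_comm, abs_of_nonneg (by linarith)]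
        linarith
      · have := hbd θ t ht
        rwa [iteratedDeriv_succ, iteratedDeriv_one] at this
    · rw [hzero' θ r hr fun h => by linarith [h.2], norm_zero]
      exact mul_nonneg (hG0 θ) hB0.le
  have hb0 : ∀ (θ : S2) (r : ℝ), 0 < r → ‖f (r • (θ : E3))‖ ≤ G θ * B * B := by
    intro θ r hr
    by_cases hrB : r ≤ B
    · have := (convex_Ioi (0 : ℝ)).norm_image_sub_le_of_norm_deriv_le
        (f := fun t : ℝ => f (t • (θ : E3))) (C := G θ * B) (x := B) (y := r)
        (fun t _ => (hd1 θ) t) (fun t ht => hb1 θ t ht) hB0 hr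
      rw [hzero θ B hB0 hBm, sub_zero] at this
      refine this.trans (mul_le_mul_of_nonneg_left ?_ (mul_nonneg (hG0 θ) hB0.le))
      rw [Real.norm_eq_abs, abs_sub_comm, abs_of_nonneg (by linarith)]
      linarith
    · rw [hzero θ r hr fun h => by linarith [h.2], norm_zero]
      exact mul_nonneg (mul_nonneg (hG0 θ) hB0.le) hB0.le
  have hC : ∀ θ, 0 ≤ G θ * B ∧ 0 ≤ G θ * B * B := fun θ =>
    ⟨mul_nonneg (hG0 θ) hB0.le, mul_nonneg (mul_nonneg (hG0 θ) hB0.le) hB0.le⟩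
  -- The shell is enlarged to `(a/2, B)` so that `f` and its radial derivative vanish at the
  -- endpoints themselves, as the boundary terms require.
  refine ⟨a / 2, B, fun θ => (1 + B + B * B) * G θ, by positivity, by linarith,
    hG.const_mul _, fun θ r hr => ⟨?_, ?_, ?_, fun hrm => ?_⟩⟩
  · have := hb0 θ r hr
    have := hC θ
    have := hG0 θ
    nlinarith
  · have := hb1 θ r hr
    have := hC θ
    have := hG0 θ
    nlinarith
  · have := hbd θ r hr
    have := hC θ
    nlinarith
  · have : r ∉ Icc a b := fun h => hrm ⟨by linarith [h.1], by linarith [h.2]⟩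
    exact ⟨hzero θ r hr this, hzero' θ r hr this⟩

end Polar

/-! ### Coefficients in a Hilbert basis: differentiation under the integral and Parseval. -/

section Coefficients

variable {X : Type*} [MeasurableSpace X] {μ : Measure X}

theorem integrable_star_mul {ψ h : X → ℂ} (hψ : MemLp ψ 2 μ) (hh : MemLp h 2 μ) :
    Integrable (fun x => star (ψ x) * h x) μ :=
  hψ.star.integrable_mul hh

/-- The difference quotients are dominated by `‖ψ‖ G`, integrable as a product of two `L²`
functions. -/
theorem hasDerivAt_integral_star_mul {ψ : X → ℂ} (hψ : MemLp ψ 2 μ) {φ φ' : ℝ → X → ℂ}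
    {G : X → ℝ} (hG : MemLp G 2 μ) (hφ : ∀ r, 0 < r → MemLp (φ r) 2 μ)
    (hφ' : ∀ r, 0 < r → MemLp (φ' r) 2 μ) (hbd : ∀ r, 0 < r → ∀ x, ‖φ' r x‖ ≤ G x)
    (hd : ∀ r, 0 < r → ∀ x, HasDerivAt (fun s => φ s x) (φ' r x) r) (r : ℝ) (hr : 0 < r) :
    HasDerivAt (fun s => ∫ x, star (ψ x) * φ s x ∂μ) (∫ x, star (ψ x) * φ' r x ∂μ) r := by
  refine (hasDerivAt_integral_of_dominated_loc_of_deriv_le (s := Ioi 0)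
    (F' := fun s x => star (ψ x) * φ' s x) (bound := fun x => ‖ψ x‖ * G x) (Ioi_mem_nhds hr) ?_ (integrable_star_mul hψ (hφ r hr))
    (integrable_star_mul hψ (hφ' r hr)).aestronglyMeasurable ?_ (hψ.norm.integrable_mul hG) ?_).2
  · filter_upwards [Ioi_mem_nhds hr] with s hs
    exact (integrable_star_mul hψ (hφ s hs)).aestronglyMeasurable
  · refine Filter.Eventually.of_forall fun x s hs => ?_
    rw [norm_mul, norm_star]
    exact mul_le_mul_of_nonneg_left (hbd s hs x) (norm_nonneg _)
  · exact Filter.Eventually.of_forall fun x s hs => (hd s hs x).const_mul _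

theorem continuousOn_integral_star_mul {ψ : X → ℂ} (hψ : MemLp ψ 2 μ) {φ : ℝ → X → ℂ}
    {G : X → ℝ} (hG : MemLp G 2 μ) (hφ : ∀ r, 0 < r → MemLp (φ r) 2 μ)
    (hbd : ∀ r, 0 < r → ∀ x, ‖φ r x‖ ≤ G x) (hc : ∀ x, Continuous fun s => φ s x) :
    ContinuousOn (fun s => ∫ x, star (ψ x) * φ s x ∂μ) (Ioi 0) := by
  refine continuousOn_of_dominated (bound := fun x => ‖ψ x‖ * G x) (fun s hs =>
    (integrable_star_mul hψ (hφ s hs)).aestronglyMeasurable) (fun s hs =>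
    Filter.Eventually.of_forall fun x => ?_) (hψ.norm.integrable_mul hG)
    (Filter.Eventually.of_forall fun x => ((hc x).const_mul _).continuousOn)
  rw [norm_mul, norm_star]
  exact mul_le_mul_of_nonneg_left (hbd s hs x) (norm_nonneg _)

theorem enorm_sq_eq_tsum_inner {H ι : Type*} [NormedAddCommGroup H]
    [InnerProductSpace ℂ H] (b : HilbertBasis ι ℂ H) (v : H) :
    ‖v‖ₑ ^ 2 = ∑' i, ‖inner ℂ (b i) v‖ₑ ^ 2 := by
  have h := b.hasSum_inner_mul_inner v v
  have h2 : HasSum (fun i => ‖inner ℂ (b i) v‖ ^ 2) (‖v‖ ^ 2) := by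
    have h3 := h.mapL Complex.reCLM
    have e : ∀ i, Complex.reCLM (inner ℂ v (b i) * inner ℂ (b i) v) = ‖inner ℂ (b i) v‖ ^ 2 := by
      intro i
      rw [← inner_conj_symm v (b i), ← Complex.normSq_eq_conj_mul_self, Complex.reCLM_apply,
        Complex.ofReal_re, Complex.normSq_eq_norm_sq]
    simp only [e, inner_self_eq_norm_sq_to_K] at h3
    convert! h3 using 1
    simp [← Complex.ofReal_pow]
  rw [← ofReal_norm, ← ENNReal.ofReal_pow (norm_nonneg v), ← h2.tsum_eq,
    ENNReal.ofReal_tsum_of_nonneg (fun i => sq_nonneg _) h2.summable]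
  congr 1
  funext i
  rw [← ofReal_norm, ← ENNReal.ofReal_pow (norm_nonneg _)]

theorem inner_eq_integral_star_mul (v w : Lp ℂ 2 μ) {h : X → ℂ} (hw : (w : X → ℂ) =ᵐ[μ] h) :
    inner ℂ v w = ∫ x, star ((v : X → ℂ) x) * h x ∂μ := by
  rw [L2.inner_def]
  refine integral_congr_ae ?_
  filter_upwards [hw] with x hx
  rw [hx, RCLike.inner_apply, mul_comm]
  rfl

theorem eLpNorm_two_sq {E : Type*} [NormedAddCommGroup E] (h : X → E) :
    eLpNorm h 2 μ ^ 2 = ∫⁻ x, ‖h x‖ₑ ^ 2 ∂μ := by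
  rw [eLpNorm_eq_lintegral_rpow_enorm_toReal two_ne_zero ENNReal.ofNat_ne_top, ← ENNReal.rpow_two,
    ← ENNReal.rpow_mul]
  simp

theorem lintegral_enorm_sq_eq_tsum {ι : Type*} (b : HilbertBasis ι ℂ (Lp ℂ 2 μ)) {h : X → ℂ}
    (hh : MemLp h 2 μ) :
    ∫⁻ x, ‖h x‖ₑ ^ 2 ∂μ = ∑' i, ‖∫ x, star ((b i : X → ℂ) x) * h x ∂μ‖ₑ ^ 2 := by
  rw [← eLpNorm_two_sq, ← Lp.enorm_toLp hh, enorm_sq_eq_tsum_inner b]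
  simp_rw [inner_eq_integral_star_mul _ _ hh.coeFn_toLp]

end Coefficients

/-! ### Summation over modes and the main theorem. -/

theorem aemeasurable_weighted_enorm_sq {h : ℝ → ℂ} (hh : ContinuousOn h (Ioi 0)) :
    AEMeasurable (fun r => ENNReal.ofReal (r ^ 2) * ‖h r‖ₑ ^ 2) (volume.restrict (Ioi 0)) := by
  have h1 : AEMeasurable h (volume.restrict (Ioi 0)) := hh.aemeasurable measurableSet_Ioi
  fun_prop

/-- The Rellich inequality for an operator in the angular variable with a Hilbert basis of
eigenvectors. -/
theorem rellich_of_hilbertBasis {ι : Type*} [Countable ι] {L : L2S2 →ₗ.[ℂ] L2S2}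
    (hsym : (-L).IsFormalAdjoint (-L)) (b : HilbertBasis ι ℂ L2S2) {l : ι → ℝ}
    (hb : ∀ i, ∃ h : b i ∈ (-L).domain, (-L) ⟨b i, h⟩ = (l i : ℂ) • b i) (hl : ∀ i, 0 ≤ l i)
    {K : ℝ} (hK : 0 ≤ K) (hlK : ∀ i, l i ^ 2 ≤ K * (l i - 3 / 4) ^ 2)
    {f g : E3 → ℂ} (hf : IsAdmissible f) (hfg : IsAngularImage L f g) :
    eLpNorm (fun x => g x / ((‖x‖ ^ 2 : ℝ) : ℂ)) 2 volume ^ 2 ≤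
      ENNReal.ofReal K *
        eLpNorm (fun x => radialLaplacian f x + g x / ((‖x‖ ^ 2 : ℝ) : ℂ)) 2 volume ^ 2 := by
  obtain ⟨α, β, G, hα, hαβ, hG, hbd⟩ := hf.exists_bounds
  set D1 : ℝ → S2 → ℂ := fun r θ => deriv (fun t : ℝ => f (t • (θ : E3))) r with hD1
  set D2 : ℝ → S2 → ℂ := fun r θ => iteratedDeriv 2 (fun t : ℝ => f (t • (θ : E3))) r with hD2
  have hm0 : Measurable (Function.uncurry fun (r : ℝ) (θ : S2) => f (r • (θ : E3))) :=
    hf.measurable.comp (f := fun p : ℝ × S2 => p.1 • (p.2 : E3)) (by fun_prop)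
  have hm1 : Measurable (Function.uncurry D1) :=
    measurable_uncurry_deriv hm0 fun θ => (hf.contDiff θ).differentiable (by norm_num)
  have hm2 : Measurable (Function.uncurry D2) :=
    measurable_uncurry_iteratedDeriv_two hm0 hf.contDiff
  have hL0 : ∀ r : ℝ, 0 < r → MemLp (fun θ : S2 => f (r • (θ : E3))) 2 surf := fun r hr =>
    hG.mono' (hm0.comp (measurable_prodMk_left (x := r))).aestronglyMeasurable
      (Filter.Eventually.of_forall fun θ => (hbd θ r hr).1)
  have hL1 : ∀ r : ℝ, 0 < r → MemLp (D1 r) 2 surf := fun r hr =>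
    hG.mono' (hm1.comp measurable_prodMk_left).aestronglyMeasurable
      (Filter.Eventually.of_forall fun θ => (hbd θ r hr).2.1)
  have hL2 : ∀ r : ℝ, 0 < r → MemLp (D2 r) 2 surf := fun r hr =>
    hG.mono' (hm2.comp measurable_prodMk_left).aestronglyMeasurable
      (Filter.Eventually.of_forall fun θ => (hbd θ r hr).2.2.1)
  set u : ι → ℝ → ℂ := fun i r => ∫ θ, star ((b i : S2 → ℂ) θ) * f (r • (θ : E3)) ∂surf with hu
  set u1 : ι → ℝ → ℂ := fun i r => ∫ θ, star ((b i : S2 → ℂ) θ) * D1 r θ ∂surf with hu1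
  set u2 : ι → ℝ → ℂ := fun i r => ∫ θ, star ((b i : S2 → ℂ) θ) * D2 r θ ∂surf with hu2
  have hd1 : ∀ i r, 0 < r → HasDerivAt (u i) (u1 i r) r := fun i =>
    hasDerivAt_integral_star_mul (Lp.memLp (b i)) hG hL0 hL1 (fun r hr θ => (hbd θ r hr).2.1)
      fun r _ θ => ((hf.contDiff θ).differentiable (by norm_num) r).hasDerivAt
  have hd2 : ∀ i r, 0 < r → HasDerivAt (u1 i) (u2 i r) r := fun i =>
    hasDerivAt_integral_star_mul (Lp.memLp (b i)) hG hL1 hL2 (fun r hr θ => (hbd θ r hr).2.2.1)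
      fun r _ θ => by
        have := ((hf.contDiff θ).differentiable_iteratedDeriv 1 (by norm_num) r).hasDerivAt
        rwa [← iteratedDeriv_succ, iteratedDeriv_one] at this
  have hc2 : ∀ i, ContinuousOn (u2 i) (Ioi 0) := fun i =>
    continuousOn_integral_star_mul (Lp.memLp (b i)) hG hL2 (fun r hr θ => (hbd θ r hr).2.2.1)
      fun θ => (hf.contDiff θ).continuous_iteratedDeriv 2 le_rfl
  have hc0 : ∀ i, ContinuousOn (u i) (Ioi 0) := fun i r hr =>
    (hd1 i r hr).continuousAt.continuousWithinAt
  have hc1 : ∀ i, ContinuousOn (u1 i) (Ioi 0) := fun i r hr =>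
    (hd2 i r hr).continuousAt.continuousWithinAt
  have hvan : ∀ i r, 0 < r → r ∉ Ioo α β → u i r = 0 ∧ u1 i r = 0 := by
    intro i r hr hrm
    constructor
    · simp only [hu, ((hbd _ r hr).2.2.2 hrm).1, mul_zero, integral_zero]
    · simp only [hu1, hD1, ((hbd _ r hr).2.2.2 hrm).2, mul_zero, integral_zero]
  have hscalar : ∀ i, ∫⁻ r in Ioi (0 : ℝ), ENNReal.ofReal (r ^ 2) *
      ‖((l i / r ^ 2 : ℝ) : ℂ) * u i r‖ₑ ^ 2 ≤
      ENNReal.ofReal K * ∫⁻ r in Ioi (0 : ℝ), ENNReal.ofReal (r ^ 2) *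
        ‖u2 i r + ((2 / r : ℝ) : ℂ) * u1 i r - ((l i / r ^ 2 : ℝ) : ℂ) * u i r‖ₑ ^ 2 := fun i =>
    lintegral_rellich hα hαβ (hl i) hK (hlK i) (hd1 i) (hd2 i) (hc2 i)
      (hvan i α hα (by simp)).1 (hvan i α hα (by simp)).2
      (hvan i β (hα.trans_le hαβ) (by simp)).1 (hvan i β (hα.trans_le hαβ) (by simp)).2
      fun r hr hrm => (hvan i r hr fun h => hrm (Ioo_subset_Ioc_self h)).1
  have hnorm : ∀ (r : ℝ) (θ : S2), 0 < r → ‖r • (θ : E3)‖ = r := fun r θ hr => by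
    simp [norm_smul, abs_of_pos hr]
  have hgdiv : AEStronglyMeasurable (fun x => g x / ((‖x‖ ^ 2 : ℝ) : ℂ)) volume :=
    (hfg.1.aemeasurable.div (by fun_prop)).aestronglyMeasurable
  have hang : ∀ᵐ r : ℝ ∂(volume.restrict (Ioi 0)),
      MemLp (fun θ : S2 => g (r • (θ : E3))) 2 surf ∧
      ∀ i, ∫ θ, star ((b i : S2 → ℂ) θ) * g (r • (θ : E3)) ∂surf = -((l i : ℂ) * u i r) := by
    filter_upwards [hfg.2] with r hr
    obtain ⟨v, hv, hLv⟩ := hr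
    refine ⟨(Lp.memLp (L v)).ae_eq hLv, fun i => ?_⟩
    obtain ⟨h, e⟩ := hb i
    rw [← inner_eq_integral_star_mul _ _ hLv, hu]
    simp only
    rw [← inner_eq_integral_star_mul _ _ hv]
    -- Symmetry moves `L` onto the eigenvector: `⟨b i, L v⟩ = -⟨(-L) b i, v⟩ = -l i ⟨b i, v⟩`. No
    -- expansion of `v` in the domain of `L` is needed.
    have hs := hsym ⟨b i, h⟩ v
    rw [e, inner_smul_left, LinearPMap.neg_apply, inner_neg_right] at hs
    rw [← neg_eq_iff_eq_neg.2 hs]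
    simp
  have hrpow : ∀ c : ℝ, ContinuousOn (fun r : ℝ => ((c / r ^ 2 : ℝ) : ℂ)) (Ioi 0) := fun c =>
    Complex.continuous_ofReal.comp_continuousOn (continuousOn_const.div (continuousOn_id.pow 2)
      fun r hr => pow_ne_zero 2 (mem_Ioi.1 hr).ne')
  have hrinv : ContinuousOn (fun r : ℝ => ((2 / r : ℝ) : ℂ)) (Ioi 0) :=
    Complex.continuous_ofReal.comp_continuousOn (continuousOn_const.div continuousOn_id
      fun r hr => (mem_Ioi.1 hr).ne')
  -- Both norms become sums over modes of weighted radial integrals, by polar coordinates, Parseval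
  -- for almost every `r`, and exchange of sum and integral. The comparison is then termwise.
  have hleft : eLpNorm (fun x => g x / ((‖x‖ ^ 2 : ℝ) : ℂ)) 2 volume ^ 2 =
      ∑' i, ∫⁻ r in Ioi (0 : ℝ), ENNReal.ofReal (r ^ 2) *
        ‖((l i / r ^ 2 : ℝ) : ℂ) * u i r‖ₑ ^ 2 := by
    rw [eLpNorm_two_sq, lintegral_polar (hgdiv.enorm.pow_const 2), ← lintegral_tsum]
    · refine lintegral_congr_ae ?_
      filter_upwards [hang, ae_restrict_mem measurableSet_Ioi] with r hr hr0
      rw [ENNReal.tsum_mul_left]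
      congr 1
      have hfun : ∀ θ : S2, g (r • (θ : E3)) / ((‖r • (θ : E3)‖ ^ 2 : ℝ) : ℂ) =
          ((1 / r ^ 2 : ℝ) : ℂ) * g (r • (θ : E3)) := fun θ => by
        rw [hnorm r θ hr0]
        push_cast
        ring
      simp_rw [hfun]
      rw [lintegral_enorm_sq_eq_tsum b (hr.1.const_mul _)]
      congr 1
      funext i
      simp_rw [mul_left_comm _ ((1 / r ^ 2 : ℝ) : ℂ), integral_const_mul, hr.2 i]
      rw [mul_neg, enorm_neg]
      congr 2
      push_cast
      ring
    · intro i
      exact aemeasurable_weighted_enorm_sq ((hrpow (l i)).mul (hc0 i))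
  have hright : eLpNorm (fun x => radialLaplacian f x + g x / ((‖x‖ ^ 2 : ℝ) : ℂ)) 2 volume ^ 2 =
      ∑' i, ∫⁻ r in Ioi (0 : ℝ), ENNReal.ofReal (r ^ 2) *
        ‖u2 i r + ((2 / r : ℝ) : ℂ) * u1 i r - ((l i / r ^ 2 : ℝ) : ℂ) * u i r‖ₑ ^ 2 := by
    rw [eLpNorm_two_sq, lintegral_polar (F := fun x =>
      ‖radialLaplacian f x + g x / ((‖x‖ ^ 2 : ℝ) : ℂ)‖ₑ ^ 2)
      ((hf.measurable_radialLaplacian.aestronglyMeasurable.add hgdiv).enorm.pow_const 2),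
      ← lintegral_tsum]
    · refine lintegral_congr_ae ?_
      filter_upwards [hang, ae_restrict_mem measurableSet_Ioi] with r hr hr0
      rw [ENNReal.tsum_mul_left]
      congr 1
      have hfun : ∀ θ : S2, radialLaplacian f (r • (θ : E3)) +
          g (r • (θ : E3)) / ((‖r • (θ : E3)‖ ^ 2 : ℝ) : ℂ) =
          D2 r θ + ((2 / r : ℝ) : ℂ) * D1 r θ + ((1 / r ^ 2 : ℝ) : ℂ) * g (r • (θ : E3)) :=
        fun θ => by
          rw [hnorm r θ hr0, radialLaplacian_smul θ hr0]
          push_cast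
          ring
      simp_rw [hfun]
      rw [lintegral_enorm_sq_eq_tsum b (h := fun θ => D2 r θ + ((2 / r : ℝ) : ℂ) * D1 r θ +
        ((1 / r ^ 2 : ℝ) : ℂ) * g (r • (θ : E3)))
        (((hL2 r hr0).add ((hL1 r hr0).const_mul _)).add (hr.1.const_mul _))]
      congr 1
      funext i
      have i0 := integrable_star_mul (Lp.memLp (b i)) hr.1
      have i1 := integrable_star_mul (Lp.memLp (b i)) (hL1 r hr0)
      have i2 := integrable_star_mul (Lp.memLp (b i)) (hL2 r hr0)
      simp_rw [mul_add, mul_left_comm (star ((b i : S2 → ℂ) _)) (Complex.ofReal _)]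
      rw [integral_add (f := fun θ => star ((b i : S2 → ℂ) θ) * D2 r θ +
        ((2 / r : ℝ) : ℂ) * (star ((b i : S2 → ℂ) θ) * D1 r θ))
        (i2.add (i1.const_mul _)) (i0.const_mul _), integral_add i2 (i1.const_mul _), integral_const_mul, integral_const_mul, hr.2 i]
      congr 2
      push_cast
      ring
    · intro i
      exact aemeasurable_weighted_enorm_sq
        (((hc2 i).add (hrinv.mul (hc1 i))).sub ((hrpow (l i)).mul (hc0 i)))
  rw [hleft, hright, ← ENNReal.tsum_mul_left]
  exact ENNReal.tsum_le_tsum hscalar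

end EvansLewis

theorem mainTheorem3
    (L : EvansLewis.L2S2 →ₗ.[ℂ] EvansLewis.L2S2)
    (hsa : IsSelfAdjoint (-L))
    (hnonneg : EvansLewis.IsNonnegOp (-L))
    (hdisc : EvansLewis.HasDiscreteSpectrum (-L))
    (hzero : (0 : ℝ) ∈ EvansLewis.eigenvalueSet (-L)) :
    ((∃ c ∈ EvansLewis.eigenvalueSet (-L), c ≠ 0) →
      ∃ c : ℝ, EvansLewis.IsMaximisingEigenvalue (-L) c) ∧
    ∀ c : ℝ, EvansLewis.IsMaximisingEigenvalue (-L) c →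
      c + EvansLewis.rellichConst 3 ≠ 0 →
      ∀ f g : EvansLewis.E3 → ℂ, EvansLewis.IsAdmissible f → EvansLewis.IsAngularImage L f g →
        eLpNorm (fun x => g x / ((‖x‖ ^ 2 : ℝ) : ℂ)) 2 volume ^ 2 ≤
          ENNReal.ofReal ((c / (c + EvansLewis.rellichConst 3)) ^ 2) *
            eLpNorm (fun x => EvansLewis.radialLaplacian f x + g x / ((‖x‖ ^ 2 : ℝ) : ℂ))
              2 volume ^ 2 := by
  refine ⟨EvansLewis.exists_isMaximisingEigenvalue hnonneg hdisc, fun c hc hcR f g hf hfg => ?_⟩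
  have hsym : (-L).IsFormalAdjoint (-L) := by
    have h := LinearPMap.adjoint_isFormalAdjoint hsa.dense_domain
    rwa [LinearPMap.isSelfAdjoint_def.1 hsa] at h
  obtain ⟨ι, b, hb⟩ := EvansLewis.exists_hilbertBasis_eigenvectors hsym hnonneg hdisc
  choose l hl hb using hb
  have : Fact ((2 : ENNReal) ≠ ⊤) := ⟨ENNReal.ofNat_ne_top⟩
  have : IsSeparable EvansLewis.surf := isSeparable_of_sigmaFinite _
  have : SecondCountableTopology EvansLewis.L2S2 :=
    Lp.SecondCountableTopology
  have : Countable ι := EvansLewis.countable_of_orthonormal b.orthonormal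
  exact EvansLewis.rellich_of_hilbertBasis hsym b hb
    (fun i => EvansLewis.eigenvalueSet_nonneg hnonneg (hl i)) (sq_nonneg _)
    (fun i => hc.sq_le hnonneg hcR (hl i)) hf hfg
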